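/- Consider a contextual slate bandit with $K$ slots and actions $[d_k]=\{1,\dots,d_k\}$ in slot $k$. Let $(X_i,A_i,R_i)$, $i=1,2,\dots$, be i.i.d. copies of $(X,A,R)$, where $X\sim\mathbb P_X$ is a context, the slate $A=(A_1,\dots,A_K)\in\prod_k[d_k]$ is drawn from a logging policy $\mu(\cdot\mid X)$ that is factored, $\mu(a\mid x)=\prod_{k=1}^K\mu_k(a_k\mid x)$ with each $\mu_k(\cdot\mid x)$ a probability distribution on $[d_k]$, and the real-valued reward $R$ is drawn from a conditional distribution given $(X,A)$. Let $\pi(a\mid x)$ be a target policy (not necessarily factored) with slot marginals $\pi(a_k\mid x)$, and assume that the logging policy covers it slot by slot: for almost every $x$, $\pi(a_k\mid x)>0$ implies $\mu_k(a_k\mid x)>0$, for all $k$ and all $a_k\in[d_k]$. Put $$Y_k=\frac{\pi(A_k\mid X)}{\mu_k(A_k\mid X)},\qquad G=1+\sum_{k=1}^K(Y_k-1),\qquad \theta=\mathbb E[GR],$$ $$\Gamma_\beta=GR-\beta(G-1),\qquad V_\beta=\operatorname{Var}(\Gamma_\beta)\qquad(\beta\in\mathbb R),$$ and assume $\mathbb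 E|GR|<\infty$ and $\mathbb E[\Gamma_\theta^2]<\infty$ (so that $V_\theta<\infty$; this holds in particular if $GR$ and all $Y_k$ have finite variance). Write $\mathbb E_n[f(X,A,R)]=\frac1n\sum_{i=1}^n f(X_i,A_i,R_i)$, and let $$\hat\theta_n^{\mathrm{wPI}}=\frac{\mathbb E_n[GR]}{\mathbb E_n[G]},\qquad \hat\theta_n^{(\beta)}=\mathbb E_n[\Gamma_\beta]$$ be the self-normalized pseudoinverse (wPI) estimator, with the value $0$ when $\mathbb E_n[G]=0$, and the control-variate estimator with single weight $\beta$. Then, as $n\to\infty$, $$\sqrt n\,(\hat\theta_n^{\mathrm{wPI}}-\theta)\to_d\mathcal N(0,V_\theta).$$ Moreover, the wPI estimator is asymptotically equivalent to the control-variate estimator with single weight $\beta=\theta$: also $\sqrt n\,(\hat\theta_n^{(\theta)}-\theta)\to_d\mathcal N(0,V_\theta)$, and $\sqrt n\,(\hat\theta_n^{\mathrm{wPI}}-\hat\theta_n^{(\theta)})\to_p0$. -/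

import Mathlib

open MeasureTheory ProbabilityTheory Filter

/-- A slate with `K` slots: one action `a k` out of the `d k` actions of slot `k`, for every `k`. -/
abbrev Slate {K : ℕ} (d : Fin K → ℕ) : Type := ∀ k : Fin K, Fin (d k)

/-- One logged triplet `((x, a), r)`: context, slate taken, reward. -/
abbrev Obs (𝒳 : Type*) {K : ℕ} (d : Fin K → ℕ) : Type _ := (𝒳 × Slate d) × ℝ

/-- An off-policy evaluation problem for a contextual slate bandit with a factored logging policy. -/
structure SlateBandit (𝒳 : Type*) [MeasurableSpace 𝒳] {K : ℕ} (d : Fin K → ℕ) where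
  /-- distribution of the context -/
  context : Measure 𝒳
  /-- logging policy `μ(a | x)` -/
  logging : Kernel 𝒳 (Slate d)
  /-- slot-level logging policies `μ_k(a_k | x)` -/
  slotLogging : ∀ k : Fin K, Kernel 𝒳 (Fin (d k))
  /-- target policy `π(a | x)`, not necessarily factored -/
  target : Kernel 𝒳 (Slate d)
  /-- conditional distribution of the reward given context and slate -/
  reward : Kernel (𝒳 × Slate d) ℝ
  context_prob : IsProbabilityMeasure context
  logging_markov : IsMarkovKernel logging
  slotLogging_markov : ∀ k, IsMarkovKernel (slotLogging k)
  target_markov : IsMarkovKernel target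
  reward_markov : IsMarkovKernel reward
  /-- the logging policy is factored: `μ(a | x) = ∏ k, μ_k(a_k | x)` -/
  factored : ∀ (x : 𝒳) (a : Slate d), logging x {a} = ∏ k, slotLogging k x {a k}

namespace SlateBandit

noncomputable section

variable {𝒳 : Type*} [MeasurableSpace 𝒳] {K : ℕ} {d : Fin K → ℕ}

/-- The law of a generic logged triplet: `X` has the context distribution, `A ∼ μ(· | X)`, and `R`
is drawn from the reward distribution given `(X, A)`. -/
def law (M : SlateBandit 𝒳 d) : Measure (Obs 𝒳 d) :=
  (M.context.compProd M.logging).compProd M.reward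

/-- The marginal probability `π(a_k | x)` that the target policy plays action `b` in slot `k`. -/
def targetSlot (M : SlateBandit 𝒳 d) (k : Fin K) (x : 𝒳) (b : Fin (d k)) : ℝ :=
  (M.target x).real {a | a k = b}

/-- The slot-level density ratio `Y_k = π(A_k | X) / μ_k(A_k | X)`. -/
def Y (M : SlateBandit 𝒳 d) (k : Fin K) (z : Obs 𝒳 d) : ℝ :=
  M.targetSlot k z.1.1 (z.1.2 k) / (M.slotLogging k z.1.1).real {z.1.2 k}

/-- `G = 1 + ∑ k, (Y_k - 1)`. -/
def G (M : SlateBandit 𝒳 d) (z : Obs 𝒳 d) : ℝ := 1 + ∑ k, (M.Y k z - 1)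

/-- The product `G R`. -/
def GR (M : SlateBandit 𝒳 d) (z : Obs 𝒳 d) : ℝ := M.G z * z.2

/-- The target parameter `θ = 𝔼[G R]`. -/
def θ (M : SlateBandit 𝒳 d) : ℝ := ∫ z, M.GR z ∂M.law

/-- `Γ_β = G R - β (G - 1)`: the single control variate `G - 1` with weight `β`. -/
def Γ (M : SlateBandit 𝒳 d) (β : ℝ) (z : Obs 𝒳 d) : ℝ := M.GR z - β * (M.G z - 1)

/-- `V_β = Var(Γ_β)`. -/
def V (M : SlateBandit 𝒳 d) (β : ℝ) : ℝ := variance (M.Γ β) M.law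

/-- Slot-wise coverage: for almost every context, every action that the target policy can play in a
slot has positive probability under the logging policy of that slot. -/
def Covers (M : SlateBandit 𝒳 d) : Prop :=
  ∀ᵐ x ∂M.context, ∀ (k : Fin K) (b : Fin (d k)),
    M.targetSlot k x b ≠ 0 → M.slotLogging k x {b} ≠ 0

/-- The empirical mean `𝔼_n[f] = (1/n) ∑ f(Z_i)` over the first `n` observations. -/
def empMean (f : Obs 𝒳 d → ℝ) (n : ℕ) (z : ℕ → Obs 𝒳 d) : ℝ :=
  (1 / (n : ℝ)) * ∑ i ∈ Finset.range n, f (z i)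

/-- The self-normalized PI estimator `𝔼_n[G R] / 𝔼_n[G]`. -/
def wPI (M : SlateBandit 𝒳 d) (n : ℕ) (z : ℕ → Obs 𝒳 d) : ℝ :=
  empMean M.GR n z / empMean M.G n z

/-- The single-control-variate estimator `𝔼_n[Γ_β]`. -/
def cvEstimator (M : SlateBandit 𝒳 d) (β : ℝ) (n : ℕ) (z : ℕ → Obs 𝒳 d) : ℝ :=
  empMean (M.Γ β) n z

end

end SlateBandit

open scoped Topology

/-! ### Slutsky-type tools for ratios -/

namespace MeasureTheory

/-! Write `N`, `D` for the empirical means of `GR` and `G`. For n ≥ 1 the control-variate estimator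
with weight θ is `N - θ (D - 1)`, the linearization of `N / D` at `(θ, 1)`, and when `D ≠ 0` the
error factors exactly: `N / D - (N - θ (D - 1)) = (N - θ D) (D⁻¹ - 1)`. Scaled by √n, the first
factor converges in law by the CLT for `Γ θ`; the second tends to 0 almost surely by the strong law,
since coverage gives `G` mean one. Slutsky gives the equivalence and hence the limit for wPI. Only
`Γ θ` needs a second moment; `G` need only be integrable. -/

/-- Convergence in distribution to a constant implies convergence in probability. -/
lemma TendstoInDistribution.tendstoInMeasure_const {Ω Ω' : Type*} {mΩ : MeasurableSpace Ω}
    {mΩ' : MeasurableSpace Ω'} {P : Measure Ω} [IsProbabilityMeasure P] {P' : Measure Ω'}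
    [IsProbabilityMeasure P'] {X : ℕ → Ω → ℝ} {c : ℝ}
    (h : TendstoInDistribution X atTop (fun _ ↦ c) (fun _ ↦ P) P') :
    TendstoInMeasure P X atTop (fun _ ↦ c) := by
  rw [tendstoInMeasure_iff_dist]
  intro ε hε
  have hclosed : IsClosed {x : ℝ | ε ≤ dist x c} :=
    isClosed_le continuous_const (continuous_id.dist continuous_const)
  -- Portmanteau for a closed set that the Dirac limit does not charge.
  have key := ProbabilityMeasure.limsup_measure_closed_le_of_tendsto h.tendsto hclosed
  have hlim : P'.map (fun _ : Ω' ↦ c) {x : ℝ | ε ≤ dist x c} = 0 := by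
    rw [Measure.map_apply (by fun_prop) hclosed.measurableSet]
    simp [not_le.2 hε]
  have hX (n : ℕ) : P.map (X n) {x : ℝ | ε ≤ dist x c} = P {ω | ε ≤ dist (X n ω) c} := by
    rw [Measure.map_apply_of_aemeasurable (h.forall_aemeasurable n) hclosed.measurableSet]
    rfl
  simp only [ProbabilityMeasure.coe_mk, hlim, hX] at key
  exact tendsto_of_le_liminf_of_limsup_le bot_le key

/-- If `√n (N - θ D)` converges in distribution and `D → 1` almost surely, then the ratio `N / D`
is asymptotically equivalent, at scale `√n`, to its linearization `N - θ (D - 1)`. -/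
lemma tendstoInMeasure_sqrt_mul_div_sub {Ω Ω' : Type*} {mΩ : MeasurableSpace Ω}
    {mΩ' : MeasurableSpace Ω'} {P : Measure Ω} [IsProbabilityMeasure P] {P' : Measure Ω'}
    [IsProbabilityMeasure P'] {W : Ω' → ℝ} {N D : ℕ → Ω → ℝ} {θ : ℝ}
    (hN : ∀ n, AEMeasurable (N n) P) (hD : ∀ n, AEMeasurable (D n) P)
    (hD1 : ∀ᵐ ω ∂P, Tendsto (fun n ↦ D n ω) atTop (𝓝 1))
    (hS : TendstoInDistribution
      (fun (n : ℕ) ω ↦ Real.sqrt n * (N n ω - θ * (D n ω - 1) - θ)) atTop W (fun _ ↦ P) P') :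
    TendstoInMeasure P
      (fun (n : ℕ) ω ↦ Real.sqrt n * (N n ω / D n ω - (N n ω - θ * (D n ω - 1))))
      atTop (fun _ ↦ (0 : ℝ)) := by
  have hDinv : TendstoInMeasure P (fun n ω ↦ (D n ω)⁻¹ - 1) atTop (fun _ ↦ (0 : ℝ)) := by
    refine tendstoInMeasure_of_tendsto_ae (fun n ↦ ?_) ?_
    · exact ((hD n).inv.sub_const 1).aestronglyMeasurable
    · filter_upwards [hD1] with ω hω
      simpa using (hω.inv₀ one_ne_zero).sub_const 1
  have hprod := hS.continuous_comp_prodMk_of_tendstoInMeasure_const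
    (g := fun p : ℝ × ℝ ↦ p.1 * p.2) (by fun_prop) hDinv (fun n ↦ (hD n).inv.sub_const 1)
  simp only [mul_zero] at hprod
  refine TendstoInDistribution.tendstoInMeasure_const
    (tendstoInDistribution_of_tendstoInMeasure_sub _ _ hprod ?_ fun n ↦ ?_)
  · refine tendstoInMeasure_of_tendsto_ae (fun n ↦ ?_) ?_
    · refine AEMeasurable.aestronglyMeasurable (AEMeasurable.sub ?_ ?_)
      · exact (((hN n).div (hD n)).sub
          ((hN n).sub (((hD n).sub_const 1).const_mul θ))).const_mul _
      · exact ((((hN n).sub (((hD n).sub_const 1).const_mul θ)).sub_const θ).const_mul _).mul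
          ((hD n).inv.sub_const 1)
    · filter_upwards [hD1] with ω hω
      refine tendsto_const_nhds.congr' ?_
      -- The factorization needs `D n ω ≠ 0`, which holds eventually; the value of the ratio at `D =
      -- 0` is therefore immaterial.
      filter_upwards [hω.eventually_ne one_ne_zero] with n hn
      simp only [Pi.sub_apply, Pi.zero_apply]
      field_simp
      ring
  · exact (((hN n).div (hD n)).sub
      ((hN n).sub (((hD n).sub_const 1).const_mul θ))).const_mul _

end MeasureTheory

namespace SlateBandit

variable {𝒳 : Type*} [MeasurableSpace 𝒳] {K : ℕ} {d : Fin K → ℕ}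

instance (M : SlateBandit 𝒳 d) : IsProbabilityMeasure M.context := M.context_prob

instance (M : SlateBandit 𝒳 d) : IsMarkovKernel M.logging := M.logging_markov

instance (M : SlateBandit 𝒳 d) (k : Fin K) : IsMarkovKernel (M.slotLogging k) :=
  M.slotLogging_markov k

instance (M : SlateBandit 𝒳 d) : IsMarkovKernel M.target := M.target_markov

instance (M : SlateBandit 𝒳 d) : IsMarkovKernel M.reward := M.reward_markov

instance (M : SlateBandit 𝒳 d) : IsProbabilityMeasure M.law := by
  unfold law
  infer_instance

/-! ### Measurability and means of the density ratios -/

lemma measurable_densityRatio (M : SlateBandit 𝒳 d) (k : Fin K) :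
    Measurable fun p : 𝒳 × Slate d ↦
      M.targetSlot k p.1 (p.2 k) / (M.slotLogging k p.1).real {p.2 k} := by
  refine measurable_from_prod_countable_left fun a ↦ Measurable.div ?_ ?_
  · exact (M.target.measurable_coe
      (Set.toFinite {a' : Slate d | a' k = a k}).measurableSet).ennreal_toReal
  · exact ((M.slotLogging k).measurable_coe (measurableSet_singleton _)).ennreal_toReal

lemma measurable_Y (M : SlateBandit 𝒳 d) (k : Fin K) : Measurable (M.Y k) :=
  (M.measurable_densityRatio k).comp measurable_fst

lemma measurable_G (M : SlateBandit 𝒳 d) : Measurable M.G :=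
  (Finset.measurable_fun_sum _ fun k _ ↦ (M.measurable_Y k).sub_const 1).const_add 1

lemma measurable_GR (M : SlateBandit 𝒳 d) : Measurable M.GR :=
  M.measurable_G.mul measurable_snd

lemma measurable_Γ (M : SlateBandit 𝒳 d) (β : ℝ) : Measurable (M.Γ β) :=
  M.measurable_GR.sub ((M.measurable_G.sub_const 1).const_mul β)

lemma targetSlot_nonneg (M : SlateBandit 𝒳 d) (k : Fin K) (x : 𝒳) (b : Fin (d k)) :
    0 ≤ M.targetSlot k x b :=
  measureReal_nonneg

lemma Y_nonneg (M : SlateBandit 𝒳 d) (k : Fin K) (z : Obs 𝒳 d) : 0 ≤ M.Y k z :=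
  div_nonneg measureReal_nonneg measureReal_nonneg

/-- Under the factored logging policy, the action of slot `k` is drawn from `μ_k`. -/
lemma map_eval_logging (M : SlateBandit 𝒳 d) (k : Fin K) (x : 𝒳) :
    (M.logging x).map (fun a ↦ a k) = M.slotLogging k x := by
  have h : M.logging x = Measure.pi fun k ↦ M.slotLogging k x :=
    Measure.ext_of_singleton fun a ↦ by rw [M.factored, Measure.pi_singleton]
  rw [h]
  exact (measurePreserving_eval _ k).map_eq

lemma sum_targetSlot (M : SlateBandit 𝒳 d) (k : Fin K) (x : 𝒳) :
    ∑ b, ENNReal.ofReal (M.targetSlot k x b) = 1 := by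
  have h (b : Fin (d k)) : ENNReal.ofReal (M.targetSlot k x b) =
      (M.target x).map (fun a ↦ a k) {b} := by
    rw [Measure.map_apply (measurable_pi_apply k) (measurableSet_singleton b), targetSlot,
      ofReal_measureReal]
    rfl
  have := Measure.isProbabilityMeasure_map (μ := M.target x) (measurable_pi_apply k).aemeasurable
  simp_rw [h]
  rw [sum_measure_singleton, Finset.coe_univ, measure_univ]

/-- If the slot logging policy covers the target at the context `x`, then the density ratio of the
slot has conditional mean one given `x`. -/
lemma lintegral_densityRatio (M : SlateBandit 𝒳 d) (k : Fin K) (x : 𝒳)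
    (hx : ∀ b, M.targetSlot k x b ≠ 0 → M.slotLogging k x {b} ≠ 0) :
    ∫⁻ a, ENNReal.ofReal (M.targetSlot k x (a k) / (M.slotLogging k x).real {a k})
      ∂M.logging x = 1 := by
  rw [← lintegral_map (μ := M.logging x) (g := fun a ↦ a k)
    (f := fun b ↦ ENNReal.ofReal (M.targetSlot k x b / (M.slotLogging k x).real {b}))
    (measurable_of_finite _) (measurable_pi_apply k), M.map_eval_logging, lintegral_fintype,
    ← M.sum_targetSlot k x]
  refine Finset.sum_congr rfl fun b _ ↦ ?_
  rw [← ofReal_measureReal (μ := M.slotLogging k x) (s := {b}),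
    ← ENNReal.ofReal_mul (div_nonneg (M.targetSlot_nonneg k x b) measureReal_nonneg)]
  congr 1
  -- Coverage is used only here: a zero denominator would lose target mass unless the numerator
  -- vanishes too.
  by_cases hb : M.targetSlot k x b = 0
  · simp [hb]
  · exact div_mul_cancel₀ _ ((measureReal_ne_zero_iff (measure_ne_top _ _)).2 (hx b hb))

/-- Under slot-wise coverage, the density ratio of a slot has mean one. -/
lemma lintegral_Y (M : SlateBandit 𝒳 d) (hcover : M.Covers) (k : Fin K) :
    ∫⁻ z, ENNReal.ofReal (M.Y k z) ∂M.law = 1 := by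
  rw [law, Measure.lintegral_compProd (M.measurable_Y k).ennreal_ofReal]
  simp only [Y, lintegral_const, measure_univ, mul_one]
  rw [Measure.lintegral_compProd (M.measurable_densityRatio k).ennreal_ofReal,
    lintegral_congr_ae (g := fun _ ↦ 1)
      (hcover.mono fun x hx ↦ M.lintegral_densityRatio k x (hx k))]
  simp

/-- By nonnegativity, the finite lower integral already gives integrability, so no moment assumption
on the ratios is needed. -/
lemma integrable_Y (M : SlateBandit 𝒳 d) (hcover : M.Covers) (k : Fin K) :
    Integrable (M.Y k) M.law :=
  (lintegral_ofReal_ne_top_iff_integrable (M.measurable_Y k).aestronglyMeasurable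
    (ae_of_all _ (M.Y_nonneg k))).1 (by simp [M.lintegral_Y hcover k])

lemma integral_Y (M : SlateBandit 𝒳 d) (hcover : M.Covers) (k : Fin K) :
    ∫ z, M.Y k z ∂M.law = 1 := by
  rw [integral_eq_lintegral_of_nonneg_ae (ae_of_all _ (M.Y_nonneg k))
    (M.measurable_Y k).aestronglyMeasurable, M.lintegral_Y hcover, ENNReal.toReal_one]

lemma integrable_G (M : SlateBandit 𝒳 d) (hcover : M.Covers) : Integrable M.G M.law :=
  (integrable_const 1).add
    (integrable_finsetSum _ fun k _ ↦ (M.integrable_Y hcover k).sub (integrable_const 1))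

lemma integral_G (M : SlateBandit 𝒳 d) (hcover : M.Covers) : ∫ z, M.G z ∂M.law = 1 := by
  have hsub (k : Fin K) : Integrable (fun z ↦ M.Y k z - 1) M.law :=
    (M.integrable_Y hcover k).sub (integrable_const 1)
  unfold G
  rw [integral_add (integrable_const 1) (integrable_finsetSum _ fun k _ ↦ hsub k),
    integral_finsetSum _ fun k _ ↦ hsub k]
  simp [integral_sub (M.integrable_Y hcover _) (integrable_const (1 : ℝ)), M.integral_Y hcover]

/-- The control variate `G - 1` is centered, so every `Γ_β` has mean `θ`. -/
lemma integral_Γ (M : SlateBandit 𝒳 d) (hcover : M.Covers) (hGR : Integrable M.GR M.law) (β : ℝ) :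
    ∫ z, M.Γ β z ∂M.law = M.θ := by
  have hG := M.integrable_G hcover
  have hG1 : Integrable (fun z ↦ M.G z - 1) M.law := hG.sub (integrable_const 1)
  unfold Γ
  rw [integral_sub hGR (hG1.const_mul β), integral_const_mul,
    integral_sub hG (integrable_const 1), M.integral_G hcover]
  simp [θ]

lemma empMean_Γ (M : SlateBandit 𝒳 d) (β : ℝ) {n : ℕ} (hn : n ≠ 0) (z : ℕ → Obs 𝒳 d) :
    empMean (M.Γ β) n z = empMean M.GR n z - β * (empMean M.G n z - 1) := by
  have hn' : (n : ℝ) ≠ 0 := Nat.cast_ne_zero.2 hn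
  simp only [empMean, Γ, Finset.sum_sub_distrib, ← Finset.mul_sum, Finset.sum_const,
    Finset.card_range, nsmul_eq_mul, mul_one]
  field_simp

/-! ### Limit theorems for the i.i.d. sample -/

section Sampling

variable {M : SlateBandit 𝒳 d} {Ω : Type*} [MeasurableSpace Ω] {P : Measure Ω}
  {Z : ℕ → Ω → Obs 𝒳 d} {f : Obs 𝒳 d → ℝ}

lemma identDistrib_comp (hlaw : ∀ i, HasLaw (Z i) M.law P) (hf : Measurable f) (i : ℕ) :
    IdentDistrib (fun ω ↦ f (Z i ω)) (fun ω ↦ f (Z 0 ω)) P P :=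
  IdentDistrib.comp ⟨(hlaw i).aemeasurable, (hlaw 0).aemeasurable,
    (hlaw i).map_eq.trans (hlaw 0).map_eq.symm⟩ hf

lemma aemeasurable_empMean (hlaw : ∀ i, HasLaw (Z i) M.law P) (hf : Measurable f) (n : ℕ) :
    AEMeasurable (fun ω ↦ empMean f n (fun i ↦ Z i ω)) P :=
  (Finset.aemeasurable_fun_sum _ fun i _ ↦ hf.comp_aemeasurable (hlaw i).aemeasurable).const_mul _

lemma integral_comp_sample (hlaw : ∀ i, HasLaw (Z i) M.law P) (hf : Measurable f) (i : ℕ) :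
    ∫ ω, f (Z i ω) ∂P = ∫ z, f z ∂M.law :=
  (hlaw i).integral_comp hf.aestronglyMeasurable

lemma tendsto_empMean_ae (hlaw : ∀ i, HasLaw (Z i) M.law P) (hindep : iIndepFun Z P)
    (hf : Measurable f) (hint : Integrable f M.law) :
    ∀ᵐ ω ∂P, Tendsto (fun n ↦ empMean f n (fun i ↦ Z i ω)) atTop (𝓝 (∫ z, f z ∂M.law)) := by
  have hint0 : Integrable (fun ω ↦ f (Z 0 ω)) P := by
    rw [← (hlaw 0).map_eq] at hint
    exact hint.comp_aemeasurable (hlaw 0).aemeasurable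
  have h := strong_law_ae_real (fun i ω ↦ f (Z i ω)) hint0
    (fun i j hij ↦ (hindep.indepFun hij).comp hf hf) (identDistrib_comp hlaw hf)
  filter_upwards [h] with ω hω
  rw [integral_comp_sample hlaw hf] at hω
  simpa only [empMean, one_div, div_eq_inv_mul, mul_one] using hω

lemma tendstoInDistribution_empMean [IsProbabilityMeasure P]
    (hlaw : ∀ i, HasLaw (Z i) M.law P) (hindep : iIndepFun Z P)
    (hf : Measurable f) (hL2 : MemLp f 2 M.law) :
    TendstoInDistribution
      (fun (n : ℕ) ω ↦ Real.sqrt n * (empMean f n (fun i ↦ Z i ω) - ∫ z, f z ∂M.law))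
      atTop (id : ℝ → ℝ) (fun _ ↦ P) (gaussianReal 0 (variance f M.law).toNNReal) := by
  have hvar : variance (fun ω ↦ f (Z 0 ω)) P = variance f M.law := by
    rw [← (hlaw 0).map_eq, variance_map hf.aemeasurable (hlaw 0).aemeasurable]
    rfl
  have hL2' : MemLp (fun ω ↦ f (Z 0 ω)) 2 P := by
    rw [← (hlaw 0).map_eq] at hL2
    exact hL2.comp_of_map (hlaw 0).aemeasurable
  have h := tendstoInDistribution_inv_sqrt_mul_sum_sub (P := P) (X := fun i ω ↦ f (Z i ω))
    (P' := gaussianReal 0 (variance f M.law).toNNReal) (Y := id)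
    (by rw [hvar]; exact HasLaw.id) hL2' (hindep.comp (fun _ ↦ f) fun _ ↦ hf)
    (identDistrib_comp hlaw hf)
  convert! h using 3 with n ω
  rw [integral_comp_sample hlaw hf, empMean]
  rcases eq_or_ne n 0 with rfl | hn
  · simp
  have hs : Real.sqrt n ≠ 0 := (Real.sqrt_pos.2 (Nat.cast_pos.2 hn.bot_lt)).ne'
  have hsq : (n : ℝ) = Real.sqrt n * Real.sqrt n := (Real.mul_self_sqrt n.cast_nonneg).symm
  generalize Real.sqrt n = s at *
  rw [hsq]
  field_simp

end Sampling

end SlateBandit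

theorem lemma4 {𝒳 : Type*} [MeasurableSpace 𝒳] {K : ℕ} {d : Fin K → ℕ} (M : SlateBandit 𝒳 d)
    (hcover : M.Covers)
    (hGR : Integrable M.GR M.law)
    (hV : MemLp (M.Γ M.θ) 2 M.law)
    {Ω : Type*} [MeasurableSpace Ω] (P : Measure Ω) [IsProbabilityMeasure P]
    (Z : ℕ → Ω → Obs 𝒳 d)
    (hlaw : ∀ i, HasLaw (Z i) M.law P)
    (hindep : iIndepFun Z P) :
    TendstoInDistribution
        (fun (n : ℕ) ω ↦ Real.sqrt n * (M.wPI n (fun i ↦ Z i ω) - M.θ))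
        atTop (id : ℝ → ℝ) (fun _ ↦ P) (gaussianReal 0 (M.V M.θ).toNNReal) ∧
      TendstoInDistribution
        (fun (n : ℕ) ω ↦ Real.sqrt n * (M.cvEstimator M.θ n (fun i ↦ Z i ω) - M.θ))
        atTop (id : ℝ → ℝ) (fun _ ↦ P) (gaussianReal 0 (M.V M.θ).toNNReal) ∧
      TendstoInMeasure P
        (fun (n : ℕ) ω ↦ Real.sqrt n *
          (M.wPI n (fun i ↦ Z i ω) - M.cvEstimator M.θ n (fun i ↦ Z i ω)))
        atTop (fun _ ↦ (0 : ℝ)) := by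
  have hcv := SlateBandit.tendstoInDistribution_empMean hlaw hindep (M.measurable_Γ M.θ) hV
  rw [M.integral_Γ hcover hGR] at hcv
  have hGmean := SlateBandit.tendsto_empMean_ae hlaw hindep M.measurable_G (M.integrable_G hcover)
  rw [M.integral_G hcover] at hGmean
  have hmGR := SlateBandit.aemeasurable_empMean hlaw M.measurable_GR
  have hmG := SlateBandit.aemeasurable_empMean hlaw M.measurable_G
  have hlin (n : ℕ) (ω : Ω) (c : ℝ) :
      Real.sqrt n * (c * SlateBandit.empMean (M.Γ M.θ) n (fun i ↦ Z i ω)) =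
      Real.sqrt n * (c * (SlateBandit.empMean M.GR n (fun i ↦ Z i ω) -
        M.θ * (SlateBandit.empMean M.G n (fun i ↦ Z i ω) - 1))) := by
    -- At `n = 0` the linearization identity can fail, but the factor √n kills both sides.
    rcases eq_or_ne n 0 with rfl | hn
    · simp
    · rw [M.empMean_Γ _ hn]
  have hdiff : TendstoInMeasure P
      (fun (n : ℕ) ω ↦ Real.sqrt n *
        (M.wPI n (fun i ↦ Z i ω) - M.cvEstimator M.θ n (fun i ↦ Z i ω)))
      atTop (fun _ ↦ (0 : ℝ)) := by
    convert! tendstoInMeasure_sqrt_mul_div_sub hmGR hmG hGmean (θ := M.θ) (W := (id : ℝ → ℝ))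
      (P' := gaussianReal 0 (M.V M.θ).toNNReal) ?_ using 3 with n ω
    · have := hlin n ω 1
      simp only [SlateBandit.wPI, SlateBandit.cvEstimator]
      linear_combination -this
    · convert! hcv using 3 with n ω
      linear_combination -hlin n ω 1
  refine ⟨?_, hcv, hdiff⟩
  refine tendstoInDistribution_of_tendstoInMeasure_sub _ _ hcv ?_ fun n ↦ ?_
  · convert! hdiff using 3 with n ω
    simp only [Pi.sub_apply, SlateBandit.cvEstimator]
    ring
  · exact (((hmGR n).div (hmG n)).sub_const _).const_mul _
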